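/- For integers $n\ge k\ge 1$ and a vector $\mathbf x=(x_1,\dots,x_n)$ with positive components (subscripts are read modulo $n$, so $x_{n+i}=x_i$), let $$S_{n,k}(\mathbf x)=\sum_{i=1}^n \frac{x_i}{x_{i+1}+x_{i+2}+\dots+x_{i+k}},\qquad A(n,k)=\inf_{\mathbf x>0} S_{n,k}(\mathbf x),$$ $$B(k)=\inf_{n\ge k}\frac{k}{n}A(n,k),\qquad C=\inf_{k\ge 1}B(k).$$ There is exactly one line that is tangent both to the graph of $y=e^{-x}$ and to the graph of $y=x/(e^x-1)$ (with the value $1$ at $x=0$), where the two tangency points may be different. Let $\Gamma$ be its $y$-intercept. Then $\Gamma\approx 0.930498$, correctly rounded to six decimals (that is, $|\Gamma-0.930498|\le 5\cdot 10^{-7}$), and $$\ln 2\le C\le \Gamma .$$ -/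

import Mathlib

namespace Diananda

/-- The interval sum `x i + x (i+1) + ... + x (i+k-1)`. -/
noncomputable def intervalSum (x : ℕ → ℝ) (i k : ℕ) : ℝ :=
  ∑ j ∈ Finset.range k, x (i + j)

/-- The cyclic sum `∑ x i / (x (i+1) + ... + x (i+k))` over `1 ≤ i ≤ n`
(evaluated on sequences of period `n`, see `positiveCyclic`). -/
noncomputable def cyclicSum (n k : ℕ) (x : ℕ → ℝ) : ℝ :=
  ∑ i ∈ Finset.Icc 1 n, x i / intervalSum x (i + 1) k

/-- The positive vectors with `n` components, with subscripts read modulo `n`: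
positive sequences such that `x (i + n) = x i`. -/
def positiveCyclic (n : ℕ) : Set (ℕ → ℝ) :=
  {x | (∀ i, 0 < x i) ∧ Function.Periodic x n}

/-- The infimum of the cyclic sum over positive vectors. -/
noncomputable def A (n k : ℕ) : ℝ :=
  sInf (cyclicSum n k '' positiveCyclic n)

/-- The infimum of `(k / n) * A n k` over all `n ≥ k`. -/
noncomputable def B (k : ℕ) : ℝ :=
  sInf {b : ℝ | ∃ n : ℕ, k ≤ n ∧ b = (k : ℝ) / (n : ℝ) * A n k}

/-- The infimum of `B k` over all `k ≥ 1`. -/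
noncomputable def C : ℝ :=
  sInf {c : ℝ | ∃ k : ℕ, 1 ≤ k ∧ c = B k}

/-! The three infima are taken over non-empty sets of non-negative numbers
(non-emptiness is clear for `B` and `C`). -/

theorem image_nonempty (n k : ℕ) : (cyclicSum n k '' positiveCyclic n).Nonempty :=
  ⟨_, fun _ => 1, ⟨fun _ => one_pos, fun _ => rfl⟩, rfl⟩

theorem cyclicSum_nonneg {n k : ℕ} {x : ℕ → ℝ} (hx : x ∈ positiveCyclic n) :
    0 ≤ cyclicSum n k x :=
  Finset.sum_nonneg fun i _ => div_nonneg (hx.1 i).le (Finset.sum_nonneg fun _ _ => (hx.1 _).le)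

theorem A_nonneg (n k : ℕ) : 0 ≤ A n k := by
  apply Real.sInf_nonneg
  rintro _ ⟨x, hx, rfl⟩
  exact cyclicSum_nonneg hx

theorem B_nonneg (k : ℕ) : 0 ≤ B k := by
  apply Real.sInf_nonneg
  rintro _ ⟨n, _, rfl⟩
  exact mul_nonneg (by positivity) (A_nonneg n k)

/-- The function `x / (e^x - 1)`, with its continuous value `1` at `x = 0`. -/
noncomputable def gInf (x : ℝ) : ℝ :=
  if x = 0 then 1 else x / (Real.exp x - 1)

/-- The line `y = m * x + c` is tangent to the graph of `f` (at some point). -/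
def IsTangentLine (f : ℝ → ℝ) (m c : ℝ) : Prop :=
  ∃ a : ℝ, f a = m * a + c ∧ HasDerivAt f m a

/-- The line `y = m * x + c` is a common tangent to the graphs of
`y = e^(-x)` and `y = x / (e^x - 1)`. -/
def IsCommonTangent (m c : ℝ) : Prop :=
  IsTangentLine (fun x => Real.exp (-x)) m c ∧ IsTangentLine gInf m c

end Diananda

/-! Lower bound: in k consecutive terms, enlarging each denominator to the whole tail of a window of
length 2k makes the terms dominate telescoping logarithms (`log_le_sum_div_intervalSum`). The result
is log(1 + t), where t is the ratio of two adjacent k-sums, and AM-GM gives log 2 + (log t)/2.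
Summed cyclically, the log t cancel.

Upper bound: take M spikes spaced k apart and growing by e^a, each costing e^(-a), then about N
blocks of exponential decay at rate β per block, each costing nearly β/(1 - e^(-β)) = `gInf (-β)`
for large k. Periodicity forces M : N ≈ β : a, so the average cost per block tends to the height at
0 of the chord joining the two graphs over a and -β. At the tangency points this chord is the common
tangent, of height Γ.

The tangent exists by the intermediate value theorem on a tiny interval, which also locates Γ; it is
unique because `gInf` is convex on the negative axis. -/

namespace Diananda

open Real

/-! ### Tangent lines of the two graphs; uniqueness of the common one. -/

/-- The negated slope of the graph of `x / (e^x - 1)` at `b ≠ 0`. -/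
noncomputable def negSlope (b : ℝ) : ℝ :=
  (1 - exp b + b * exp b) / (1 - exp b) ^ 2

theorem hasDerivAt_gInf {b : ℝ} (hb : b ≠ 0) : HasDerivAt gInf (-negSlope b) b := by
  have hy : exp b - 1 ≠ 0 := by
    rw [sub_ne_zero]; simpa using hb
  have hy' : 1 - exp b ≠ 0 := by
    intro h; apply hy; linarith
  have h : HasDerivAt (fun x : ℝ => x / (exp x - 1))
      ((1 * (exp b - 1) - b * exp b) / (exp b - 1) ^ 2) b :=
    (hasDerivAt_id b).div ((hasDerivAt_exp b).sub_const 1) hy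
  have h2 : HasDerivAt gInf ((1 * (exp b - 1) - b * exp b) / (exp b - 1) ^ 2) b := by
    apply h.congr_of_eventuallyEq
    filter_upwards [isOpen_ne.mem_nhds hb] with x hx
    simp [gInf, show x ≠ 0 from hx]
  convert h2 using 1
  unfold negSlope
  field_simp
  ring

theorem gInf_of_ne {b : ℝ} (hb : b ≠ 0) : gInf b = b / (exp b - 1) := by simp [gInf, hb]

theorem hasDerivAt_sub_two_mul_exp (x : ℝ) :
    HasDerivAt (fun x : ℝ => (x - 2) * exp x + x + 2) (1 * exp x + (x - 2) * exp x + 1) x :=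
  ((((hasDerivAt_id x).sub_const 2).mul (hasDerivAt_exp x)).add (hasDerivAt_id x)).add_const 2

/-- The sign of this function, which vanishes at 0, decides the convexity of `gInf` on the negative
axis and gives 1 - x/2 ≤ `gInf x` for x > 0. -/
theorem monotone_sub_two_mul_exp : Monotone (fun x : ℝ => (x - 2) * exp x + x + 2) := by
  apply monotone_of_deriv_nonneg
  · exact fun x => (hasDerivAt_sub_two_mul_exp x).differentiableAt
  · intro x
    rw [(hasDerivAt_sub_two_mul_exp x).deriv]
    have h1 : -x + 1 ≤ exp (-x) := add_one_le_exp (-x)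
    have h2 : exp (-x) * exp x = 1 := by rw [← exp_add]; simp
    nlinarith [exp_pos x]

theorem antitoneOn_negSlope : AntitoneOn negSlope (Set.Iio 0) := by
  have hd : ∀ x < (0 : ℝ), HasDerivAt negSlope
      (((-exp x + (1 * exp x + x * exp x)) * (1 - exp x) ^ 2 -
        (1 - exp x + x * exp x) * (2 * (1 - exp x) * -exp x)) / ((1 - exp x) ^ 2) ^ 2) x := by
    intro x hx
    have hy : exp x < 1 := exp_lt_one_iff.2 hx
    have hn : (1 - exp x) ^ 2 ≠ 0 := pow_ne_zero _ (by linarith)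
    have h1 : HasDerivAt (fun x : ℝ => 1 - exp x) (-exp x) x := (hasDerivAt_exp x).const_sub 1
    have h2 := h1.add ((hasDerivAt_id x).mul (hasDerivAt_exp x))
    have h3 := h2.div (h1.pow 2) hn
    have h4 : HasDerivAt negSlope _ x := h3
    exact h4.congr_deriv (by simp)
  refine antitoneOn_of_deriv_nonpos (convex_Iio 0) ?_ ?_ ?_
  · exact fun x hx => (hd x hx).continuousAt.continuousWithinAt
  · rw [interior_Iio]
    exact fun x hx => (hd x hx).differentiableAt.differentiableWithinAt
  · rw [interior_Iio]
    intro x hx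
    rw [(hd x hx).deriv]
    have hy : exp x < 1 := exp_lt_one_iff.2 hx
    apply div_nonpos_of_nonpos_of_nonneg _ (by positivity)
    have h0 := monotone_sub_two_mul_exp (show x ≤ 0 from (show x < 0 from hx).le)
    simp only [zero_sub, exp_zero, mul_one, add_zero] at h0
    have : ((-exp x + (1 * exp x + x * exp x)) * (1 - exp x) ^ 2 -
        (1 - exp x + x * exp x) * (2 * (1 - exp x) * -exp x))
        = exp x * (1 - exp x) * ((x - 2) * exp x + x + 2) := by ring
    rw [this]
    apply mul_nonpos_of_nonneg_of_nonpos
    · exact mul_nonneg (exp_pos x).le (by linarith)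
    · linarith

theorem convexOn_gInf : ConvexOn ℝ (Set.Iio 0) gInf := by
  have hd : ∀ x ∈ Set.Iio (0 : ℝ), HasDerivAt gInf (-negSlope x) x :=
    fun x hx => hasDerivAt_gInf (ne_of_lt hx)
  apply MonotoneOn.convexOn_of_deriv (convex_Iio 0)
  · exact fun x hx => (hd x hx).continuousAt.continuousWithinAt
  · rw [interior_Iio]
    exact fun x hx => (hd x hx).differentiableAt.differentiableWithinAt
  · rw [interior_Iio]
    intro x hx y hy hxy
    rw [(hd x hx).deriv, (hd y hy).deriv]
    exact neg_le_neg (antitoneOn_negSlope hx hy hxy)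

/-- A tangent line of `gInf` at a negative point supports the graph on the negative half-line. -/
theorem tangent_le_gInf {m c b x : ℝ} (hb : b < 0) (hx : x < 0) (h : gInf b = m * b + c)
    (hd : HasDerivAt gInf m b) : m * x + c ≤ gInf x := by
  rcases lt_trichotomy x b with h1 | h1 | h1
  · have := convexOn_gInf.slope_le_of_hasDerivAt hx hb h1 hd
    rw [slope_def_field, div_le_iff₀ (by linarith)] at this
    linarith
  · subst h1; linarith
  · have := convexOn_gInf.le_slope_of_hasDerivAt hb hx h1 hd
    rw [slope_def_field, le_div_iff₀ (by linarith)] at this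
    linarith

theorem hasDerivAt_exp_neg (a : ℝ) : HasDerivAt (fun x : ℝ => exp (-x)) (-exp (-a)) a := by
  have := (hasDerivAt_neg a).exp
  simpa using this

theorem isTangentLine_exp_neg_iff {m c : ℝ} :
    IsTangentLine (fun x => exp (-x)) m c ↔ ∃ a, m = -exp (-a) ∧ c = exp (-a) * (1 + a) := by
  constructor
  · rintro ⟨a, h, hd⟩
    have hm := hd.unique (hasDerivAt_exp_neg a)
    refine ⟨a, hm, ?_⟩
    subst hm
    simp only at h
    linarith
  · rintro ⟨a, rfl, rfl⟩
    exact ⟨a, by ring, hasDerivAt_exp_neg a⟩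

theorem isTangentLine_gInf_of_neg {b : ℝ} (hb : b < 0) :
    IsTangentLine gInf (-negSlope b) (gInf b + b * negSlope b) :=
  ⟨b, by ring, hasDerivAt_gInf hb.ne⟩

/-- Excludes tangency at 0: a tangent of e^(-x) through (0, 1) has slope -1, but 1 - x/2 ≤ `gInf x`
on the right forces slope at least -1/2. -/
theorem not_hasDerivAt_gInf_zero : ¬ HasDerivAt gInf (-1) 0 := by
  intro h
  have h1 : Filter.Tendsto (slope gInf 0) (nhdsWithin 0 (Set.Ioi 0)) (nhds (-1)) :=
    (hasDerivAt_iff_tendsto_slope.1 h).mono_left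
      (nhdsWithin_mono _ fun x hx => ne_of_gt (show (0 : ℝ) < x from hx))
  have h2 : (-(1 / 2) : ℝ) ≤ -1 := by
    refine ge_of_tendsto h1 ?_
    filter_upwards [self_mem_nhdsWithin] with x hx
    have hx : 0 < x := hx
    have he : 0 < exp x - 1 := by linarith [add_one_lt_exp hx.ne']
    rw [slope_def_field, le_div_iff₀ (by linarith), gInf_of_ne hx.ne']
    have h0 := monotone_sub_two_mul_exp hx.le
    simp only [zero_sub, exp_zero, mul_one, add_zero] at h0
    have : 1 - x / 2 ≤ x / (exp x - 1) := by
      rw [le_div_iff₀ he]; nlinarith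
    simp only [gInf, if_true]
    linarith
  norm_num at h2

/-- The points of tangency of a common tangent. -/
theorem IsCommonTangent.exists_points {m c : ℝ} (h : IsCommonTangent m c) :
    ∃ a b, 0 < a ∧ b < 0 ∧ m = -exp (-a) ∧ c = exp (-a) * (1 + a) ∧
      gInf b = m * b + c ∧ m = -negSlope b ∧ HasDerivAt gInf m b := by
  obtain ⟨h1, b, hb, hd⟩ := h
  obtain ⟨a, rfl, rfl⟩ := isTangentLine_exp_neg_iff.1 h1
  have hneg : b < 0 := by
    rcases lt_trichotomy b 0 with h0 | h0 | h0
    · exact h0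
    · exfalso
      subst h0
      have ha : a = 0 := by
        by_contra hne
        have := add_one_lt_exp hne
        have h2 : exp (-a) * exp a = 1 := by rw [← exp_add]; simp
        simp only [gInf, if_true, mul_zero, zero_add] at hb
        nlinarith [exp_pos (-a)]
      subst ha
      simp only [neg_zero, exp_zero] at hd
      exact not_hasDerivAt_gInf_zero hd
    · exfalso
      have he : 0 < exp b - 1 := by linarith [add_one_lt_exp h0.ne']
      -- No tangency at b > 0: there `gInf` lies strictly above e^(-x), which lies above all its
      -- tangents.
      have h2 : exp (-b) < gInf b := by
        rw [gInf_of_ne h0.ne', lt_div_iff₀ he]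
        have h3 : exp (-b) * exp b = 1 := by rw [← exp_add]; simp
        have h4 : -b + 1 < exp (-b) := add_one_lt_exp (by linarith)
        linarith
      have h5 : exp (-b) = exp (-a) * exp (a - b) := by rw [← exp_add]; congr 1; ring
      have h6 := add_one_le_exp (a - b)
      nlinarith [exp_pos (-a)]
  have hs := hd.unique (hasDerivAt_gInf hneg.ne)
  refine ⟨a, b, ?_, hneg, rfl, rfl, hb, hs, hd⟩
  have hy : exp b < 1 := exp_lt_one_iff.2 hneg
  have h1 : negSlope b < 1 := by
    unfold negSlope
    rw [div_lt_one (by apply pow_pos; linarith)]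
    nlinarith [exp_pos b, add_one_lt_exp hneg.ne]
  have : exp (-a) < 1 := by linarith
  simpa using exp_lt_one_iff.1 this

/-- The quantity compared is the height at b of the tangent to e^(-x) at a. With `tangent_le_gInf`,
two distinct common tangents would contradict it. -/
theorem exp_neg_mul_strictAnti {a₁ a₂ b : ℝ} (hb : b ≤ a₁) (h : a₁ < a₂) :
    exp (-a₂) * (1 + a₂ - b) < exp (-a₁) * (1 + a₁ - b) := by
  have h1 : exp (-a₁) = exp (-a₂) * exp (a₂ - a₁) := by rw [← exp_add]; congr 1; ring
  have h2 : a₂ - a₁ + 1 < exp (a₂ - a₁) := add_one_lt_exp (by linarith)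
  rw [h1, mul_assoc]
  apply mul_lt_mul_of_pos_left _ (exp_pos _)
  nlinarith

theorem IsCommonTangent.unique {m c m' c' : ℝ} (h : IsCommonTangent m c)
    (h' : IsCommonTangent m' c') : m' = m ∧ c' = c := by
  obtain ⟨a, b, ha, hb, rfl, rfl, hg, -, hd⟩ := h.exists_points
  obtain ⟨a', b', ha', hb', rfl, rfl, hg', -, hd'⟩ := h'.exists_points
  have : a' = a := by
    rcases lt_trichotomy a a' with h1 | h1 | h1
    · have := tangent_le_gInf hb hb' hg hd
      have := exp_neg_mul_strictAnti (b := b') (by linarith) h1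
      linarith
    · exact h1.symm
    · have := tangent_le_gInf hb' hb hg' hd'
      have := exp_neg_mul_strictAnti (b := b) (by linarith) h1
      linarith
  subst this
  exact ⟨rfl, rfl⟩

/-- The tangent to e^(-x) of slope -s has intercept s - s log s, concave in s. This bound and
`le_add_negMulLog` agree with it to first order at s = e^(-a), so one anchor a gives sharp two-sided
estimates nearby. -/
theorem add_negMulLog_le {s : ℝ} (hs : 0 < s) (a : ℝ) : s + negMulLog s ≤ exp (-a) + a * s := by
  have h : log (exp (-a) / s) ≤ exp (-a) / s - 1 :=
    log_le_sub_one_of_pos (div_pos (exp_pos _) hs)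
  rw [log_div (exp_pos _).ne' hs.ne', log_exp] at h
  have h2 : s * (exp (-a) / s) = exp (-a) := mul_div_cancel₀ _ hs.ne'
  unfold negMulLog
  nlinarith

theorem le_add_negMulLog {s : ℝ} (hs : 0 < s) (a : ℝ) :
    s * (2 + a - s / exp (-a)) ≤ s + negMulLog s := by
  have h : log (s / exp (-a)) ≤ s / exp (-a) - 1 :=
    log_le_sub_one_of_pos (div_pos hs (exp_pos _))
  rw [log_div hs.ne' (exp_pos _).ne', log_exp] at h
  unfold negMulLog
  nlinarith

theorem add_negMulLog_mono {s t : ℝ} (hs : 0 < s) (hst : s ≤ t) (ht : t ≤ 1) :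
    s + negMulLog s ≤ t + negMulLog t := by
  have h0 := add_negMulLog_le hs (-log t)
  rw [neg_neg, exp_log (by linarith)] at h0
  have h1 : log t ≤ 0 := log_nonpos (by linarith) ht
  have h2 : t + negMulLog t = t + -log t * t := by unfold negMulLog; ring
  rw [h2]
  nlinarith

theorem abs_exp_neg_sub_le {x : ℝ} (h0 : 0 ≤ x) (h1 : x ≤ 1) :
    |exp (-x) - ∑ m ∈ Finset.range 14, (-x) ^ m / m.factorial| ≤ 1 / 80000000000 := by
  have h := Real.exp_bound (x := -x) (by rwa [abs_neg, abs_of_nonneg h0]) (n := 14) (by norm_num)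
  refine h.trans ?_
  rw [abs_neg, abs_of_nonneg h0]
  calc x ^ 14 * _ ≤ 1 * ((Nat.succ 14 : ℝ) / ((Nat.factorial 14 : ℕ) * (14 : ℕ))) :=
        mul_le_mul_of_nonneg_right (pow_le_one₀ h0 h1) (by positivity)
    _ ≤ _ := by norm_num [Nat.factorial]

end Diananda

/-! ### Numerical existence of the common tangent. -/

namespace Diananda

open Real

/-- The anchor 0.42903 puts e^(-a) within about 3e-6 of the slopes at both bracketing points, so the
quadratic error is negligible. -/
theorem exp_neg_slope_anchor :
    0.6511403946 ≤ exp (-0.42903) ∧ exp (-0.42903) ≤ 0.6511403948 := by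
  have h := abs_le.1 (abs_exp_neg_sub_le (x := 0.42903) (by norm_num) (by norm_num))
  norm_num [Finset.sum_range_succ, Nat.factorial] at h
  norm_num
  constructor <;> linarith

theorem exp_neg_lower_point :
    0.3933356343 ≤ exp (-0.933092) ∧ exp (-0.933092) ≤ 0.3933356345 := by
  have h := abs_le.1 (abs_exp_neg_sub_le (x := 0.933092) (by norm_num) (by norm_num))
  norm_num [Finset.sum_range_succ, Nat.factorial] at h
  norm_num
  constructor <;> linarith

theorem exp_neg_upper_point :
    0.3933379943 ≤ exp (-0.933086) ∧ exp (-0.933086) ≤ 0.3933379945 := by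
  have h := abs_le.1 (abs_exp_neg_sub_le (x := 0.933086) (by norm_num) (by norm_num))
  norm_num [Finset.sum_range_succ, Nat.factorial] at h
  norm_num
  constructor <;> linarith

theorem negSlope_lower_point :
    0.651138342 ≤ negSlope (-0.933092) ∧ negSlope (-0.933092) ≤ 0.651138344 := by
  obtain ⟨h1, h2⟩ := exp_neg_lower_point
  unfold negSlope
  set y := exp (-0.933092)
  have hp : (0 : ℝ) < (1 - y) ^ 2 := by apply pow_pos; linarith
  rw [le_div_iff₀ hp, div_le_iff₀ hp]
  constructor <;> nlinarith

theorem negSlope_upper_point :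
    0.651137425 ≤ negSlope (-0.933086) ∧ negSlope (-0.933086) ≤ 0.651137427 := by
  obtain ⟨h1, h2⟩ := exp_neg_upper_point
  unfold negSlope
  set y := exp (-0.933086)
  have hp : (0 : ℝ) < (1 - y) ^ 2 := by apply pow_pos; linarith
  rw [le_div_iff₀ hp, div_le_iff₀ hp]
  constructor <;> nlinarith

theorem gInf_lower_point : gInf (-0.933092) ≤ 1.538069572 := by
  obtain ⟨h1, h2⟩ := exp_neg_lower_point
  rw [gInf_of_ne (by norm_num), div_le_iff_of_neg (by linarith)]
  linarith

theorem le_gInf_upper_point : 1.538065662 ≤ gInf (-0.933086) := by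
  obtain ⟨h1, h2⟩ := exp_neg_upper_point
  rw [gInf_of_ne (by norm_num), le_div_iff_of_neg (by linarith)]
  linarith

theorem le_add_negMulLog_negSlope_lower_point :
    0.93049827 ≤ negSlope (-0.933092) + negMulLog (negSlope (-0.933092)) := by
  obtain ⟨h1, h2⟩ := negSlope_lower_point
  obtain ⟨h3, h4⟩ := exp_neg_slope_anchor
  set s := negSlope (-0.933092)
  refine le_trans ?_ (le_add_negMulLog (by linarith) 0.42903)
  have h5 : s / exp (-0.42903) ≤ 0.999996852 := by
    rw [div_le_iff₀ (exp_pos _)]; linarith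
  nlinarith

theorem le_add_negMulLog_negSlope_upper_point :
    0.93049787 ≤ negSlope (-0.933086) + negMulLog (negSlope (-0.933086)) := by
  obtain ⟨h1, h2⟩ := negSlope_upper_point
  obtain ⟨h3, h4⟩ := exp_neg_slope_anchor
  set s := negSlope (-0.933086)
  refine le_trans ?_ (le_add_negMulLog (by linarith) 0.42903)
  have h5 : s / exp (-0.42903) ≤ 0.999995444 := by
    rw [div_le_iff₀ (exp_pos _)]; linarith
  nlinarith

theorem exists_isCommonTangent :
    ∃ m c : ℝ, IsCommonTangent m c ∧ |c - 0.930498| ≤ 0.0000005 := by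
  obtain ⟨l1, l2⟩ := negSlope_lower_point
  obtain ⟨u1, u2⟩ := negSlope_upper_point
  have l3 := add_negMulLog_le (s := negSlope (-0.933092)) (by linarith) 0.42903
  have u3 := add_negMulLog_le (s := negSlope (-0.933086)) (by linarith) 0.42903
  have l4 := le_add_negMulLog_negSlope_lower_point
  have u4 := le_add_negMulLog_negSlope_upper_point
  have l5 := gInf_lower_point
  have u5 := le_gInf_upper_point
  obtain ⟨h3, h4⟩ := exp_neg_slope_anchor
  -- Difference of the intercepts of the tangents of slope `-negSlope b` to the two graphs; a zero
  -- is a common tangent.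
  let F : ℝ → ℝ := fun b => gInf b + b * negSlope b - (negSlope b + negMulLog (negSlope b))
  have hF : ContinuousOn F (Set.Icc (-0.933092) (-0.933086)) := by
    have hneg : ∀ b ∈ Set.Icc (-0.933092 : ℝ) (-0.933086), b < 0 := fun b hb => by
      linarith [hb.2]
    have hs : ContinuousOn negSlope (Set.Icc (-0.933092) (-0.933086)) := by
      unfold negSlope
      apply ContinuousOn.div (by fun_prop) (by fun_prop)
      intro b hb
      exact pow_ne_zero _ (by linarith [exp_lt_one_iff.2 (hneg b hb)])
    have hg : ContinuousOn gInf (Set.Icc (-0.933092) (-0.933086)) := fun b hb =>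
      (hasDerivAt_gInf (hneg b hb).ne).continuousAt.continuousWithinAt
    exact (hg.add (continuousOn_id.mul hs)).sub
      (hs.add (continuous_negMulLog.comp_continuousOn hs))
  obtain ⟨b, hb, hb0⟩ := intermediate_value_Icc (by norm_num) hF
    (show (0 : ℝ) ∈ Set.Icc (F (-0.933092)) (F (-0.933086)) from
      ⟨by simp only [F]; linarith, by simp only [F]; linarith⟩)
  have hneg : b < 0 := by linarith [hb.2]
  have s1 := antitoneOn_negSlope (show (-0.933092 : ℝ) ∈ Set.Iio 0 by norm_num) hneg hb.1
  have s2 := antitoneOn_negSlope hneg (show (-0.933086 : ℝ) ∈ Set.Iio 0 by norm_num) hb.2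
  have c1 := add_negMulLog_mono (by linarith) s1 (by linarith)
  have c2 := add_negMulLog_mono (by linarith) s2 (by linarith)
  refine ⟨-negSlope b, gInf b + b * negSlope b, ⟨?_, isTangentLine_gInf_of_neg hneg⟩, ?_⟩
  · rw [isTangentLine_exp_neg_iff]
    have hs : 0 < negSlope b := by linarith
    refine ⟨-log (negSlope b), ?_, ?_⟩
    · rw [neg_neg, exp_log hs]
    · rw [neg_neg, exp_log hs]
      simp only [F, negMulLog] at hb0
      linarith
  · simp only [F] at hb0
    rw [abs_le]
    constructor <;> linarith

end Diananda

/-! ### The lower bound ln 2. -/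

namespace Diananda

open Finset

theorem intervalSum_pos {x : ℕ → ℝ} (hx : ∀ i, 0 < x i) (i : ℕ) {k : ℕ} (hk : 1 ≤ k) :
    0 < intervalSum x i k :=
  sum_pos (fun _ _ => hx _) ⟨0, mem_range.2 hk⟩

theorem intervalSum_periodic {x : ℕ → ℝ} {n : ℕ} (hx : Function.Periodic x n) (k : ℕ) :
    Function.Periodic (fun i => intervalSum x i k) n := by
  intro i
  unfold intervalSum
  refine sum_congr rfl fun j _ => ?_
  rw [show i + n + j = i + j + n by ring, hx]

theorem intervalSum_add (x : ℕ → ℝ) (i k l : ℕ) :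
    intervalSum x i (k + l) = intervalSum x i k + intervalSum x (i + k) l := by
  unfold intervalSum
  rw [sum_range_add]
  simp [add_assoc]

theorem intervalSum_one (x : ℕ → ℝ) (i : ℕ) : intervalSum x i 1 = x i := by
  simp [intervalSum]

theorem intervalSum_mono {x : ℕ → ℝ} (hx : ∀ i, 0 ≤ x i) (i : ℕ) {k l : ℕ} (h : k ≤ l) :
    intervalSum x i k ≤ intervalSum x i l :=
  sum_le_sum_of_subset_of_nonneg (range_mono h) fun _ _ _ => hx _

theorem sum_range_shift_of_periodic {f : ℕ → ℝ} {n : ℕ} (hf : Function.Periodic f n) (j : ℕ) :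
    ∑ i ∈ range n, f (i + j) = ∑ i ∈ range n, f i := by
  induction j with
  | zero => rfl
  | succ j ih =>
    rw [← ih]
    have h1 := sum_range_succ (fun i => f (i + j)) n
    rw [sum_range_succ'] at h1
    rw [show n + j = j + n by ring, hf, zero_add] at h1
    rw [← add_right_cancel h1]
    exact sum_congr rfl fun i _ => by congr 1; ring

theorem cyclicSum_eq_sum_range {n k : ℕ} {x : ℕ → ℝ} (hx : Function.Periodic x n) :
    cyclicSum n k x = ∑ i ∈ range n, x i / intervalSum x (i + 1) k := by
  have hf : Function.Periodic (fun i => x i / intervalSum x (i + 1) k) n := by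
    intro i
    have := intervalSum_periodic hx k (i + 1)
    simp only at this ⊢
    rw [hx, show i + n + 1 = i + 1 + n by ring, this]
  rw [← sum_range_shift_of_periodic hf 1, cyclicSum, range_eq_Ico,
    sum_Ico_add' (fun i => x i / intervalSum x (i + 1) k) 0 n 1]
  rfl

/-- With T_l the sum over the window from i + l to its fixed end, each step is log(T_l / T_(l+1)) ≤
x_(i+l) / T_(l+1), and T_(l+1) still contains the k terms of the true denominator. -/
theorem log_le_sum_div_intervalSum {x : ℕ → ℝ} (hx : ∀ i, 0 < x i) {k : ℕ} (hk : 1 ≤ k) (i : ℕ) :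
    Real.log (intervalSum x i (2 * k) / intervalSum x (i + k) k) ≤
      ∑ j ∈ range k, x (i + j) / intervalSum x (i + j + 1) k := by
  have hx' : ∀ i, 0 ≤ x i := fun i => (hx i).le
  have key : ∀ l ≤ k, Real.log (intervalSum x i (2 * k) / intervalSum x (i + l) (2 * k - l)) ≤
      ∑ j ∈ range l, x (i + j) / intervalSum x (i + j + 1) k := by
    intro l
    induction l with
    | zero =>
      intro _
      simp [div_self (intervalSum_pos hx i (show 1 ≤ 2 * k by omega)).ne']
    | succ l ih =>
      intro hl
      have h0 := intervalSum_pos hx i (show 1 ≤ 2 * k by omega)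
      have h1 := intervalSum_pos hx (i + l) (show 1 ≤ 2 * k - l by omega)
      have h2 := intervalSum_pos hx (i + (l + 1)) (show 1 ≤ 2 * k - (l + 1) by omega)
      have h3 := intervalSum_pos hx (i + (l + 1)) hk
      have h4 := intervalSum_mono hx' (i + (l + 1)) (show k ≤ 2 * k - (l + 1) by omega)
      have h5 : intervalSum x (i + l) (2 * k - l) =
          x (i + l) + intervalSum x (i + (l + 1)) (2 * k - (l + 1)) := by
        rw [show 2 * k - l = 1 + (2 * k - (l + 1)) by omega, intervalSum_add, intervalSum_one]
        rfl
      rw [sum_range_succ]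
      have h6 := ih (by omega)
      rw [Real.log_div h0.ne' h1.ne'] at h6
      rw [Real.log_div h0.ne' h2.ne']
      have h7 := Real.log_le_sub_one_of_pos (div_pos h1 h2)
      rw [Real.log_div h1.ne' h2.ne'] at h7
      have h8 : intervalSum x (i + l) (2 * k - l) / intervalSum x (i + (l + 1)) (2 * k - (l + 1)) - 1
          = x (i + l) / intervalSum x (i + (l + 1)) (2 * k - (l + 1)) := by
        rw [h5, add_div, div_self h2.ne']; ring
      have h9 : x (i + l) / intervalSum x (i + (l + 1)) (2 * k - (l + 1)) ≤
          x (i + l) / intervalSum x (i + l + 1) k :=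
        div_le_div_of_nonneg_left (hx' _) h3 h4
      linarith
  have := key k le_rfl
  rwa [show 2 * k - k = k by omega] at this

theorem log_two_add_half_log_le {t : ℝ} (ht : 0 < t) :
    Real.log 2 + Real.log t / 2 ≤ Real.log (1 + t) := by
  have h : Real.log (4 * t) ≤ Real.log ((1 + t) ^ 2) :=
    Real.log_le_log (by linarith) (by nlinarith [sq_nonneg (1 - t)])
  rw [Real.log_mul (by norm_num) ht.ne', Real.log_pow, show (4 : ℝ) = 2 ^ 2 by norm_num,
    Real.log_pow] at h
  push_cast at h
  linarith

theorem mul_log_two_le_mul_cyclicSum {n k : ℕ} (hk : 1 ≤ k) {x : ℕ → ℝ}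
    (hx : x ∈ positiveCyclic n) : n * Real.log 2 ≤ k * cyclicSum n k x := by
  obtain ⟨hpos, hper⟩ := hx
  have hf : Function.Periodic (fun i => x i / intervalSum x (i + 1) k) n := by
    intro i
    have := intervalSum_periodic hper k (i + 1)
    simp only at this ⊢
    rw [hper, show i + n + 1 = i + 1 + n by ring, this]
  have h1 : k * cyclicSum n k x =
      ∑ i ∈ range n, ∑ j ∈ range k, x (i + j) / intervalSum x (i + j + 1) k := by
    rw [sum_comm, sum_congr rfl fun j _ => sum_range_shift_of_periodic hf j,
      cyclicSum_eq_sum_range hper]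
    simp
  have h2 : ∀ i, Real.log 2 + (Real.log (intervalSum x i k) -
      Real.log (intervalSum x (i + k) k)) / 2 ≤
      ∑ j ∈ range k, x (i + j) / intervalSum x (i + j + 1) k := by
    intro i
    have p1 := intervalSum_pos hpos i hk
    have p2 := intervalSum_pos hpos (i + k) hk
    refine le_trans ?_ (log_le_sum_div_intervalSum hpos hk i)
    rw [two_mul, intervalSum_add, add_div, div_self p2.ne', add_comm _ (1 : ℝ),
      ← Real.log_div p1.ne' p2.ne']
    exact log_two_add_half_log_le (div_pos p1 p2)
  have h3 : ∑ i ∈ range n, Real.log (intervalSum x (i + k) k) =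
      ∑ i ∈ range n, Real.log (intervalSum x i k) := by
    refine sum_range_shift_of_periodic (f := fun i => Real.log (intervalSum x i k)) ?_ k
    intro i
    have := intervalSum_periodic hper k i
    simp only at this ⊢
    rw [this]
  rw [h1]
  refine le_trans (le_of_eq ?_) (sum_le_sum fun i _ => h2 i)
  rw [sum_add_distrib, ← sum_div, sum_sub_distrib, h3]
  simp

theorem log_two_le_C : Real.log 2 ≤ C := by
  refine le_csInf ⟨B 1, 1, le_rfl, rfl⟩ ?_
  rintro _ ⟨k, hk, rfl⟩
  refine le_csInf ⟨_, k, le_rfl, rfl⟩ ?_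
  rintro _ ⟨n, hn, rfl⟩
  have hk0 : (0 : ℝ) < k := by exact_mod_cast hk
  have hn0 : (0 : ℝ) < n := by exact_mod_cast (show 0 < n by omega)
  have : n / k * Real.log 2 ≤ A n k := by
    apply le_csInf (image_nonempty n k)
    rintro _ ⟨x, hx, rfl⟩
    have := mul_log_two_le_mul_cyclicSum hk hx
    rw [div_mul_eq_mul_div, div_le_iff₀ hk0]
    linarith
  rw [div_mul_eq_mul_div, div_le_iff₀ hk0] at this
  rw [div_mul_eq_mul_div, le_div_iff₀ hn0]
  linarith

end Diananda

/-! ### The upper bound Γ by spikes and exponential decay. -/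

namespace Diananda

open Finset Filter Topology

/-- The infimum `A n k` bounds the cyclic sum also at periodic vectors with some zero components,
as long as no denominator vanishes. -/
theorem A_le_cyclicSum {n k : ℕ} {x : ℕ → ℝ} (h0 : ∀ i, 0 ≤ x i) (hx : Function.Periodic x n)
    (hpos : ∀ i, 0 < intervalSum x i k) : A n k ≤ cyclicSum n k x := by
  have hc : ContinuousAt (fun δ : ℝ => cyclicSum n k (fun i => x i + δ)) 0 := by
    unfold cyclicSum
    refine tendsto_finsetSum _ fun i _ => ?_
    have hd : ContinuousAt (fun δ : ℝ => intervalSum (fun i => x i + δ) (i + 1) k) 0 := by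
      unfold intervalSum
      fun_prop
    refine ContinuousAt.div (f := fun δ : ℝ => x i + δ) (by fun_prop) hd ?_
    simpa using (hpos (i + 1)).ne'
  have ht : Tendsto (fun δ : ℝ => cyclicSum n k (fun i => x i + δ)) (𝓝[>] 0)
      (𝓝 (cyclicSum n k x)) := by
    have := hc.tendsto.mono_left (nhdsWithin_le_nhds (s := Set.Ioi 0))
    simpa using this
  refine ge_of_tendsto ht ?_
  filter_upwards [self_mem_nhdsWithin] with δ hδ
  refine csInf_le ⟨0, ?_⟩ ⟨_, ⟨fun i => add_pos_of_nonneg_of_pos (h0 i) hδ, fun i => ?_⟩, rfl⟩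
  · rintro _ ⟨y, hy, rfl⟩
    exact cyclicSum_nonneg hy
  · simp only [hx i]

theorem C_le_B {k : ℕ} (hk : 1 ≤ k) : C ≤ B k := by
  refine csInf_le ⟨0, ?_⟩ ⟨k, hk, rfl⟩
  rintro _ ⟨k, -, rfl⟩
  exact B_nonneg k

theorem B_le_div_mul_A {n k : ℕ} (h : k ≤ n) : B k ≤ (k : ℝ) / n * A n k := by
  refine csInf_le ⟨0, ?_⟩ ⟨n, h, rfl⟩
  rintro _ ⟨n, -, rfl⟩
  exact mul_nonneg (by positivity) (A_nonneg n k)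

/-- Spikes `e^(a j)` at the points `j k` with `j ≤ M`, followed by an exponential decay with the
rate `β` per `k` steps, of total mass comparable to the last spike. -/
noncomputable def mixedProfile (k M : ℕ) (a β : ℝ) (r : ℕ) : ℝ :=
  if r ≤ M * k then if k ∣ r then Real.exp (a * (r / k : ℕ)) else 0
  else Real.exp (a * M - β * ((r - M * k : ℕ) : ℝ) / k) / k

/-- The periodic extension of `mixedProfile` with period `(M + N) k`. -/
noncomputable def mixedSeq (k M N : ℕ) (a β : ℝ) (i : ℕ) : ℝ :=
  mixedProfile k M a β (i % ((M + N) * k))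

section MixedSeq

variable {k M N : ℕ} {a β : ℝ}

theorem mixedProfile_nonneg (r : ℕ) : 0 ≤ mixedProfile k M a β r := by
  unfold mixedProfile
  split_ifs <;> positivity

theorem mixedProfile_pos_of_dvd (hk : 1 ≤ k) {r : ℕ} (hr : k ∣ r) :
    0 < mixedProfile k M a β r := by
  have : (0 : ℝ) < k := by exact_mod_cast hk
  unfold mixedProfile
  split_ifs <;> positivity

theorem mixedSeq_nonneg (i : ℕ) : 0 ≤ mixedSeq k M N a β i := mixedProfile_nonneg _

theorem mixedSeq_periodic : Function.Periodic (mixedSeq k M N a β) ((M + N) * k) := by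
  intro i
  simp [mixedSeq]

theorem mixedSeq_mul (hk : 1 ≤ k) (hN : 1 ≤ N) {j : ℕ} (hj : j ≤ M) :
    mixedSeq k M N a β (j * k) = Real.exp (a * j) := by
  have h1 : j * k ≤ M * k := Nat.mul_le_mul_right k hj
  have h2 : j * k < (M + N) * k := Nat.mul_lt_mul_of_pos_right (by omega) hk
  rw [mixedSeq, Nat.mod_eq_of_lt h2, mixedProfile, if_pos h1, if_pos (dvd_mul_left k j),
    Nat.mul_div_cancel _ hk]

theorem mixedSeq_period : mixedSeq k M N a β ((M + N) * k) = 1 := by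
  simp [mixedSeq, mixedProfile]

theorem mixedSeq_eq_zero (hN : 1 ≤ N) {j l : ℕ} (hj : j < M) (h0 : l ≠ 0) (hl : l < k) :
    mixedSeq k M N a β (j * k + l) = 0 := by
  have h1 : (j + 1) * k ≤ M * k := Nat.mul_le_mul_right k hj
  have h2 : M * k ≤ (M + N) * k := Nat.mul_le_mul_right k (by omega)
  rw [add_mul, one_mul] at h1
  have h3 : ¬ k ∣ j * k + l := by
    rw [Nat.dvd_add_right (dvd_mul_left k j)]
    exact Nat.not_dvd_of_pos_of_lt (by omega) hl
  rw [mixedSeq, Nat.mod_eq_of_lt (by omega), mixedProfile, if_pos (by omega), if_neg h3]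

theorem mixedSeq_add {r : ℕ} (h0 : 1 ≤ r) (hr : r < N * k) :
    mixedSeq k M N a β (M * k + r) = Real.exp (a * M - β * r / k) / k := by
  have h2 : M * k + r < (M + N) * k := by rw [add_mul]; omega
  rw [mixedSeq, Nat.mod_eq_of_lt h2, mixedProfile, if_neg (by omega),
    show M * k + r - M * k = r by omega]

theorem le_intervalSum {x : ℕ → ℝ} (hx : ∀ i, 0 ≤ x i) {i k p : ℕ} (h1 : i ≤ p) (h2 : p < i + k) :
    x p ≤ intervalSum x i k := by
  have := single_le_sum (f := fun j => x (i + j)) (fun j _ => hx _)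
    (show p - i ∈ range k from mem_range.2 (by omega))
  simpa [intervalSum, show i + (p - i) = p by omega] using this

theorem intervalSum_mixedSeq_pos (hk : 1 ≤ k) (i : ℕ) :
    0 < intervalSum (mixedSeq k M N a β) i k := by
  have h1 := Nat.mod_add_div (i + k - 1) k
  have h2 := Nat.mod_lt (i + k - 1) hk
  -- Every window of length k contains a multiple of k, and reduction modulo the period keeps it
  -- one.
  refine lt_of_lt_of_le ?_ (le_intervalSum mixedSeq_nonneg (p := k * ((i + k - 1) / k))
    (by omega) (by omega))
  refine mixedProfile_pos_of_dvd hk ((Nat.dvd_mod_iff (dvd_mul_left k _)).2 (dvd_mul_right k _))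

theorem sum_spikes_le (hk : 1 ≤ k) (hN : 1 ≤ N) {J : ℕ} (hJ : J ≤ M) :
    ∑ i ∈ range (J * k), mixedSeq k M N a β i / intervalSum (mixedSeq k M N a β) (i + 1) k ≤
      J * Real.exp (-a) := by
  induction J with
  | zero => simp
  | succ J ih =>
    rw [add_mul, one_mul, sum_range_add]
    have h1 := ih (by omega)
    rw [sum_eq_single_of_mem 0 (mem_range.2 hk)
      fun l hl h0 => by rw [mixedSeq_eq_zero hN (by omega) h0 (mem_range.1 hl), zero_div]]
    have h2 : mixedSeq k M N a β ((J + 1) * k) ≤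
        intervalSum (mixedSeq k M N a β) (J * k + 0 + 1) k :=
      le_intervalSum mixedSeq_nonneg (by rw [add_mul]; omega) (by rw [add_mul]; omega)
    rw [mixedSeq_mul hk hN hJ] at h2
    have h3 : mixedSeq k M N a β (J * k + 0) /
        intervalSum (mixedSeq k M N a β) (J * k + 0 + 1) k ≤ Real.exp (-a) := by
      rw [div_le_iff₀ (intervalSum_mixedSeq_pos hk _), add_zero, mixedSeq_mul hk hN (by omega)]
      calc Real.exp (a * J) = Real.exp (-a) * Real.exp (a * (J + 1 : ℕ)) := by
            rw [← Real.exp_add]; congr 1; push_cast; ring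
        _ ≤ _ := mul_le_mul_of_nonneg_left h2 (Real.exp_pos _).le
    push_cast
    linarith

theorem last_spike_le (hk : 1 ≤ k) (hN : 2 ≤ N) (hβ : 0 < β) :
    mixedSeq k M N a β (M * k) / intervalSum (mixedSeq k M N a β) (M * k + 1) k ≤
      Real.exp β := by
  have hk0 : (0 : ℝ) < k := by exact_mod_cast hk
  have h2k : 2 * k ≤ N * k := Nat.mul_le_mul_right k hN
  rw [div_le_iff₀ (intervalSum_mixedSeq_pos hk _), mixedSeq_mul hk (by omega) le_rfl]
  have h : ∑ j ∈ range k, Real.exp (a * M - β) / k ≤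
      intervalSum (mixedSeq k M N a β) (M * k + 1) k := by
    refine sum_le_sum fun j hj => ?_
    have hj := mem_range.1 hj
    rw [add_assoc, mixedSeq_add (by omega) (by omega)]
    apply div_le_div_of_nonneg_right _ hk0.le
    apply Real.exp_le_exp.2
    apply sub_le_sub_left
    rw [div_le_iff₀ hk0]
    apply mul_le_mul_of_nonneg_left _ hβ.le
    exact_mod_cast (show 1 + j ≤ k by omega)
  rw [sum_const, card_range, nsmul_eq_mul, mul_div_cancel₀ _ hk0.ne'] at h
  calc Real.exp (a * M) = Real.exp β * Real.exp (a * M - β) := by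
        rw [← Real.exp_add]; congr 1; ring
    _ ≤ _ := mul_le_mul_of_nonneg_left h (Real.exp_pos _).le

/-- The denominator is a full geometric sum of ratio q = e^(-β/k), and 1 - q ≤ β/k. -/
theorem geometric_term_le (hk : 1 ≤ k) (hβ : 0 < β) {r : ℕ} (h0 : 1 ≤ r) (hr : r + k < N * k) :
    mixedSeq k M N a β (M * k + r) / intervalSum (mixedSeq k M N a β) (M * k + r + 1) k ≤
      β * Real.exp (β / k) / (1 - Real.exp (-β)) / k := by
  have hk0 : (0 : ℝ) < k := by exact_mod_cast hk
  set q := Real.exp (-(β / k)) with hq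
  have hq0 : 0 < q := Real.exp_pos _
  have hqk : q ^ k = Real.exp (-β) := by
    rw [hq, ← Real.exp_nat_mul]; congr 1; field_simp
  have hb : Real.exp (-β) < 1 := Real.exp_lt_one_iff.2 (by linarith)
  have hqi : Real.exp (β / k) = q⁻¹ := by rw [hq, Real.exp_neg, inv_inv]
  set E := mixedSeq k M N a β (M * k + r) with hE
  have hE0 : 0 < E := by
    rw [hE, mixedSeq_add h0 (by omega)]; positivity
  have h1 : intervalSum (mixedSeq k M N a β) (M * k + r + 1) k =
      E * q * ∑ j ∈ range k, q ^ j := by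
    rw [intervalSum, mul_sum]
    refine sum_congr rfl fun j hj => ?_
    have hj := mem_range.1 hj
    rw [hE, mixedSeq_add h0 (by omega), show M * k + r + 1 + j = M * k + (r + 1 + j) by ring,
      mixedSeq_add (by omega) (by omega), hq, ← Real.exp_nat_mul, div_mul_eq_mul_div,
      div_mul_eq_mul_div, ← Real.exp_add, ← Real.exp_add]
    congr 2
    push_cast
    field_simp
    ring
  have h2 : (∑ j ∈ range k, q ^ j) * (1 - q) = 1 - Real.exp (-β) := by
    rw [geom_sum_mul_neg, hqk]
  have h3 : 1 - q ≤ β / k := by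
    have := Real.add_one_le_exp (-(β / k))
    linarith
  have hS : 0 < ∑ j ∈ range k, q ^ j := sum_pos (fun j _ => pow_pos hq0 j) ⟨0, mem_range.2 hk⟩
  rw [h1, hqi, div_le_iff₀ (by positivity), ← h2]
  have h4 : 0 < 1 - q := by
    by_contra hneg
    have : (∑ j ∈ range k, q ^ j) * (1 - q) ≤ 0 :=
      mul_nonpos_of_nonneg_of_nonpos hS.le (by linarith)
    linarith
  have h5 : β * q⁻¹ / ((∑ j ∈ range k, q ^ j) * (1 - q)) / k * (E * q * ∑ j ∈ range k, q ^ j) =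
      E * (β / k / (1 - q)) := by
    field_simp
  rw [h5]
  exact le_mul_of_one_le_right hE0.le ((one_le_div h4).2 h3)

/-- In the last decay block the denominator reaches the initial spike of the next period, of height
1, and `hab` has brought the decay down to at most e^β / k. -/
theorem final_term_le (hk : 1 ≤ k) (hβ : 0 < β) (hab : a * M = β * (N + 1)) (hN : 1 ≤ N) {l : ℕ}
    (hl : l < k) :
    mixedSeq k M (N + 1) a β (M * k + (N * k + l)) /
        intervalSum (mixedSeq k M (N + 1) a β) (M * k + (N * k + l) + 1) k ≤
      Real.exp β / k := by
  have hk0 : (0 : ℝ) < k := by exact_mod_cast hk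
  have hNk : k ≤ N * k := Nat.le_mul_of_pos_left k hN
  have hn : (M + (N + 1)) * k = M * k + (N * k + k) := by ring
  have h1 : 1 ≤ intervalSum (mixedSeq k M (N + 1) a β) (M * k + (N * k + l) + 1) k := by
    rw [← mixedSeq_period (k := k) (M := M) (N := N + 1) (a := a) (β := β)]
    exact le_intervalSum mixedSeq_nonneg (by omega) (by omega)
  refine (div_le_self (mixedSeq_nonneg _) h1).trans ?_
  rw [mixedSeq_add (by omega) (by rw [add_mul]; omega)]
  apply div_le_div_of_nonneg_right _ hk0.le
  apply Real.exp_le_exp.2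
  have : β * N ≤ β * (N * k + l : ℕ) / k := by
    rw [le_div_iff₀ hk0, mul_assoc]
    apply mul_le_mul_of_nonneg_left _ hβ.le
    push_cast
    linarith [Nat.cast_nonneg (α := ℝ) l]
  rw [hab]
  linarith

theorem cyclicSum_mixedSeq_le (hk : 1 ≤ k) (hβ : 0 < β) (hab : a * M = β * (N + 1))
    (hN : 1 ≤ N) :
    cyclicSum ((M + (N + 1)) * k) k (mixedSeq k M (N + 1) a β) ≤
      M * Real.exp (-a) + N * (β * Real.exp (β / k) / (1 - Real.exp (-β))) +
        2 * Real.exp β := by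
  have hk0 : (0 : ℝ) < k := by exact_mod_cast hk
  have hNk : k ≤ N * k := Nat.le_mul_of_pos_left k hN
  have hb : Real.exp (-β) < 1 := Real.exp_lt_one_iff.2 (by linarith)
  have hn : (M + (N + 1)) * k = M * k + (N * k + k) := by ring
  have hw : 0 ≤ β * Real.exp (β / k) / (1 - Real.exp (-β)) / k := by
    have : 0 < 1 - Real.exp (-β) := by linarith
    positivity
  rw [cyclicSum_eq_sum_range mixedSeq_periodic, hn, sum_range_add, sum_range_add]
  have h1 := sum_spikes_le (k := k) (M := M) (N := N + 1) (a := a) (β := β) hk (by omega) le_rfl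
  have h2 : ∑ r ∈ range (N * k), mixedSeq k M (N + 1) a β (M * k + r) /
      intervalSum (mixedSeq k M (N + 1) a β) (M * k + r + 1) k ≤
      ∑ r ∈ range (N * k), (β * Real.exp (β / k) / (1 - Real.exp (-β)) / k +
        -- The extra summand pays for the last spike.
        if r = 0 then Real.exp β else 0) := by
    refine sum_le_sum fun r hr => ?_
    have hr := mem_range.1 hr
    split_ifs with h
    · subst h
      have := last_spike_le (k := k) (M := M) (N := N + 1) (a := a) hk (by omega) hβ
      rw [add_zero]
      linarith
    · rw [add_zero]
      exact geometric_term_le hk hβ (by omega) (by rw [add_mul]; omega)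
  have h3 : ∑ l ∈ range k, mixedSeq k M (N + 1) a β (M * k + (N * k + l)) /
      intervalSum (mixedSeq k M (N + 1) a β) (M * k + (N * k + l) + 1) k ≤
      ∑ l ∈ range k, Real.exp β / k :=
    sum_le_sum fun l hl => final_term_le hk hβ hab hN (mem_range.1 hl)
  rw [sum_add_distrib, sum_ite_eq', if_pos (mem_range.2 (by omega)), sum_const, card_range,
    nsmul_eq_mul] at h2
  rw [sum_const, card_range, nsmul_eq_mul, mul_div_cancel₀ _ hk0.ne'] at h3
  have h4 : ((N * k : ℕ) : ℝ) * (β * Real.exp (β / k) / (1 - Real.exp (-β)) / k) =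
      N * (β * Real.exp (β / k) / (1 - Real.exp (-β))) := by
    push_cast
    field_simp
  linarith

end MixedSeq

theorem mul_C_le {M N : ℕ} {a β : ℝ} (hβ : 0 < β) (hab : a * M = β * (N + 1)) (hN : 1 ≤ N) :
    (M + (N + 1)) * C ≤
      M * Real.exp (-a) + N * (β / (1 - Real.exp (-β))) + 2 * Real.exp β := by
  have hk : ∀ k : ℕ, 1 ≤ k → (M + (N + 1)) * C ≤
      M * Real.exp (-a) + N * (β * Real.exp (β / k) / (1 - Real.exp (-β))) +
        2 * Real.exp β := by
    intro k hk
    have hk0 : (0 : ℝ) < k := by exact_mod_cast hk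
    have h1 := (C_le_B hk).trans (B_le_div_mul_A (n := (M + (N + 1)) * k)
      (Nat.le_mul_of_pos_left k (by omega)))
    have h2 := (A_le_cyclicSum mixedSeq_nonneg mixedSeq_periodic
      (intervalSum_mixedSeq_pos hk)).trans (cyclicSum_mixedSeq_le hk hβ hab hN)
    refine le_trans ?_ h2
    push_cast at h1
    have h3 : (0 : ℝ) < M + (N + 1) := by positivity
    rw [show (k : ℝ) / ((M + (N + 1)) * k) = (M + (N + 1) : ℝ)⁻¹ by field_simp,
      inv_mul_eq_div, le_div_iff₀ h3] at h1
    linarith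
  have ht : Tendsto (fun k : ℕ => M * Real.exp (-a) +
      N * (β * Real.exp (β / k) / (1 - Real.exp (-β))) + 2 * Real.exp β) atTop
      (𝓝 (M * Real.exp (-a) + N * (β * Real.exp 0 / (1 - Real.exp (-β))) + 2 * Real.exp β)) := by
    have h := (Real.continuous_exp.tendsto 0).comp (tendsto_const_div_atTop_nhds_zero_nat β)
    exact ((((h.const_mul β).div_const _).const_mul _).const_add _).add_const _
  rw [Real.exp_zero, mul_one] at ht
  refine ge_of_tendsto ht ?_
  filter_upwards [eventually_ge_atTop 1] with k h using hk k h

theorem IsCommonTangent.C_le {m c : ℝ} (h : IsCommonTangent m c) : C ≤ c := by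
  obtain ⟨a, b, ha, hb, rfl, hc, hg, -, -⟩ := h.exists_points
  obtain ⟨β, rfl⟩ : ∃ β, b = -β := ⟨-b, by ring⟩
  have hβ : 0 < β := by linarith
  rw [gInf_of_ne hb.ne, show -β / (Real.exp (-β) - 1) = β / (1 - Real.exp (-β)) by
    rw [← neg_sub 1 (Real.exp (-β)), neg_div_neg_eq]] at hg
  set E := Real.exp (-a) with hE
  have hE0 : 0 < E := Real.exp_pos _
  have hc0 : 0 < c := by rw [hc]; positivity
  -- each period count `N` bounds `C` up to an error of order `1 / N`
  have key : ∀ N : ℕ, 1 ≤ N → a / β ≤ N →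
      N * (C - c) * (1 + β / a) ≤ 2 * Real.exp β + 2 * c * (1 + β / a) := by
    intro N hN haN
    set t := β / a with ht
    have ht0 : 0 < t := div_pos hβ ha
    have hta : β = t * a := by rw [ht, div_mul_cancel₀ _ ha.ne']
    -- Rounding down makes the exact closing rate β(N + 1)/M at least a, so each spike costs at most
    -- e^(-a).
    set M := ⌊t * (N + 1)⌋₊ with hM
    have hM1 : (M : ℝ) ≤ t * (N + 1) := Nat.floor_le (by positivity)
    have hM2 : t * (N + 1) < M + 1 := Nat.lt_floor_add_one _
    have hM0 : (0 : ℝ) < M := by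
      have : 1 ≤ M := Nat.le_floor (by
        rw [div_le_iff₀ hβ, hta] at haN
        have : 1 ≤ t * N := by
          by_contra hlt
          nlinarith
        push_cast
        linarith)
      exact_mod_cast this
    have h1 := mul_C_le (M := M) (N := N) (a := β * (N + 1) / M) hβ (div_mul_cancel₀ _ hM0.ne') hN
    have h2 : Real.exp (-(β * (N + 1) / M)) ≤ E := by
      apply Real.exp_le_exp.2
      apply neg_le_neg
      rw [le_div_iff₀ hM0, hta]
      nlinarith
    have h3 : M * Real.exp (-(β * (N + 1) / M)) ≤ t * (N + 1) * E :=
      mul_le_mul hM1 h2 (Real.exp_pos _).le (by positivity)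
    rw [hg] at h1
    have hC0 : 0 ≤ C := (Real.log_nonneg one_le_two).trans log_two_le_C
    have h4 : N * (1 + t) * C ≤ (M + (N + 1)) * C := by
      apply mul_le_mul_of_nonneg_right _ hC0
      linarith
    have h5 : t * (N + 1) * E + N * (-E * -β + c) ≤ (N + 1) * c * (1 + t) := by
      rw [hta, hc]
      have : 0 ≤ E * (1 + a) + E * a * t := by positivity
      nlinarith
    nlinarith [mul_pos hc0 ht0]
  by_contra! hlt
  have ht0 : 0 < 1 + β / a := by positivity
  have hd : 0 < (C - c) * (1 + β / a) := mul_pos (by linarith) ht0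
  obtain ⟨N, hN⟩ := exists_nat_gt
    (max (max 1 (a / β)) ((2 * Real.exp β + 2 * c * (1 + β / a)) / ((C - c) * (1 + β / a))))
  have h1 := (le_max_left _ _).trans_lt hN
  have h2 := (le_max_right _ _).trans_lt hN
  rw [div_lt_iff₀ hd] at h2
  have h3 := key N (by exact_mod_cast ((le_max_left _ _).trans_lt h1).le)
    ((le_max_right _ _).trans h1.le)
  linarith

end Diananda

theorem theorem1 :
    ∃ m Γ : ℝ,
      (∀ m' c : ℝ, Diananda.IsCommonTangent m' c ↔ m' = m ∧ c = Γ) ∧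
      |Γ - 0.930498| ≤ 0.0000005 ∧
      Real.log 2 ≤ Diananda.C ∧ Diananda.C ≤ Γ := by
  obtain ⟨m, c, h, hc⟩ := Diananda.exists_isCommonTangent
  refine ⟨m, c, fun m' c' => ⟨fun h' => h.unique h', ?_⟩, hc, Diananda.log_two_le_C, h.C_le⟩
  rintro ⟨rfl, rfl⟩
  exact h
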